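/- **Theorem 4.4.** A *circular order* on a set $X$ is a ternary relation $[a,b,c]$ such that: $[a,b,c]\Rightarrow[b,c,a]$; $[a,b,c]\Rightarrow$ not $[b,a,c]$; $[a,b,c]$ and $[a,c,d]$ imply $[a,b,d]$; and for distinct $a,b,c$ one has $[a,b,c]$ or $[a,c,b]$. Its *interval topology* has as a base the set $X$ and the sets $X\setminus[a,b]$, $a,b\in X$, where $[a,b]=\{x:[a,x,b]\}\cup\{a,b\}$. Let $X$ be an infinite circularly ordered set, and let a group $G$ act effectively on $X$ by automorphisms of the circular order. Suppose that the action is *ultrahomogeneous*: for all finite subsets $A,B\subseteq X$, every bijection $f:A\to B$ with $[a,b,c]\Leftrightarrow[f(a),f(b),f(c)]$ for all $a,b,c\in A$ is the restriction to $A$ of $x\mapsto gx$ for some $g\in G$. Give $G$ the topology of pointwise convergence on the discrete set $X$. A *minimal $G$-system* is a nonempty compact Hausdorff space with a continuous action of $G$ all of whose orbits are dense. A *universal minimal $G$-system* $M(G)$ is a minimal $G$-system that admits a continuous $G$-equivariant map to every minimal $G$-system; it is unique up to isomorphism of $G$-systems. Then $G$ is intrinsically circularly ordered: $M(G)$ exists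 and is a circularly ordered $G$-system, i.e. the topology of $M(G)$ is the interval topology of some circular order on $M(G)$ that is preserved by every element of $G$. If moreover $X$ is countable, then $M(G)$ is metrizable. -/

import Mathlib

universe u

section CircularOrders

/-- The closed interval `[a, b] = {x | sbtw a x b} ∪ {a, b}` of a circular order. In particular
`[a, a] = {a}`, whereas `Set.cIcc a a` is the whole space. -/
def circularClosedInterval {X : Type*} [CircularOrder X] (a b : X) : Set X :=
  {x | sbtw a x b} ∪ {a, b}

/-- The interval topology of a circular order: the sets `X \ [a, b]`, together with the whole
space, form a base of it. -/
def circularIntervalTopology (X : Type*) [CircularOrder X] : TopologicalSpace X :=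
  TopologicalSpace.generateFrom {U | ∃ a b : X, U = (circularClosedInterval a b)ᶜ}

/-- The group `G` acts by automorphisms of the circular order. -/
def PreservesCircularOrder (G X : Type*) [Group G] [MulAction G X] [CircularOrder X] : Prop :=
  ∀ (g : G) (a b c : X), sbtw a b c → sbtw (g • a) (g • b) (g • c)

/-- An ultrahomogeneous action on a circularly ordered set: an effective action by automorphisms of
the circular order such that each isomorphism between finite circularly ordered subsets is the
restriction of the action of an element of `G`. -/
structure IsUltrahomogeneousAction (G X : Type*) [Group G] [MulAction G X] [CircularOrder X] :
    Prop where
  effective : FaithfulSMul G X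
  preserves : PreservesCircularOrder G X
  extend : ∀ (A B : Finset X) (f : A ≃ B),
    (∀ a b c : A, sbtw (a : X) (b : X) (c : X) ↔ sbtw (f a : X) (f b : X) (f c : X)) →
    ∃ g : G, ∀ a : A, g • (a : X) = (f a : X)

end CircularOrders

section Flows

/-- The topology of pointwise convergence on a group `G` acting on a set `X`, where `X` is
discrete: the topology induced by `g ↦ (x ↦ g • x)` from the product topology on `X → X`. -/
def pointwiseTopology (G X : Type*) [Group G] [MulAction G X] : TopologicalSpace G :=
  TopologicalSpace.induced (fun (g : G) (x : X) => g • x)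
    (@Pi.topologicalSpace X (fun _ => X) (fun _ => ⊥))

/-- A minimal `G`-system: a nonempty compact Hausdorff space with a (jointly) continuous action of
`G` all of whose orbits are dense. -/
structure IsMinimalSystem (G M : Type*) [Group G] [TopologicalSpace G] [TopologicalSpace M]
    [MulAction G M] : Prop where
  compact : CompactSpace M
  hausdorff : T2Space M
  nonempty : Nonempty M
  continuous_action : ContinuousSMul G M
  minimal : MulAction.IsMinimal G M

/-- `M` is a universal minimal `G`-system: it is minimal and admits a continuous equivariant map
(which is automatically onto) to every minimal `G`-system `Y`. A minimal `G`-system contains a dense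
image of `G`, hence is a continuous image of the space of ultrafilters on `G`; so each of them is
isomorphic to one in the universe of `G`, and nothing is lost by taking `Y` there. -/
structure IsUniversalMinimalSystem (G M : Type u) [Group G] [TopologicalSpace G]
    [TopologicalSpace M] [MulAction G M] : Prop where
  isMinimalSystem : IsMinimalSystem G M
  universal : ∀ (Y : Type u) [TopologicalSpace Y] [MulAction G Y], IsMinimalSystem G Y →
    ∃ f : M →[G] Y, Continuous f

/-- A `G`-system `M` is circularly ordered if its topology is the interval topology of a
circular order which is preserved by every element of `G`. -/
def IsCircularlyOrderedSystem (G M : Type*) [Group G] [tM : TopologicalSpace M] [MulAction G M] :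
    Prop :=
  ∃ _ : CircularOrder M, tM = circularIntervalTopology M ∧ PreservesCircularOrder G M

/-- The topological group `G` is intrinsically circularly ordered: its universal minimal system
(which exists, and is determined up to isomorphism) is a circularly ordered `G`-system. -/
def IsIntrinsicallyCircularlyOrdered (G : Type u) [Group G] [TopologicalSpace G] : Prop :=
  (∃ (M : Type u) (_ : TopologicalSpace M) (_ : MulAction G M), IsUniversalMinimalSystem G M) ∧
  ∀ (M : Type u) [TopologicalSpace M] [MulAction G M],
    IsUniversalMinimalSystem G M → IsCircularlyOrderedSystem G M

end Flows

/-! A cut of the circle is a linear order on `X` compatible with the circular order. The cuts form a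
closed subspace of `2^(X × X)`, hence a compact Hausdorff space, metrizable when `X` is countable.
They carry an invariant circular order whose interval topology is the given topology
(`topology_eq_circularIntervalTopology`). This `G`-system is M(G).

Ultrahomogeneity enters through finite linear orders: any finite set, ordered by a cut `p`, can be
moved by `G` into any infinite set, ordered by a cut `q` (`exists_smul_of_infinite`). This gives
minimality at once.

Universality is a Ramsey argument in the style of Kechris–Pestov–Todorcevic. In a minimal system
`Y`, Ramsey's theorem and compactness yield a point `y` such that `g • y` and `g' • y` are close
whenever `g • p` and `g' • p` agree on a large enough finite set (`exists_forall_mem`). So `g • p ↦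
g • y` extends continuously from a dense orbit to all cuts.

Finally, the only continuous equivariant self-map of the space of cuts is the identity
(`equivariant_eq_id`), so every universal minimal system is isomorphic to it and inherits its order
and its metrizability. -/

theorem sbtw_or_sbtw_of_ne {X : Type*} [CircularOrder X] {a b c : X} (hab : a ≠ b) (hbc : b ≠ c)
    (hca : c ≠ a) : sbtw a b c ∨ sbtw c b a := by
  by_contra! h
  rw [sbtw_iff_not_btw, sbtw_iff_not_btw, not_not, not_not] at h
  rcases btw_antisymm h.2 h.1 with h | h | h <;> contradiction

/-! ### Cuts and the arcs between them -/

/-- A cut of a circularly ordered set, described by the linear order obtained by reading the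
circle from the cut on. -/
@[ext]
structure CircularCut (X : Type*) [CircularOrder X] where
  /-- The strict linear order determined by the cut. -/
  lt : X → X → Prop
  trans : ∀ {a b c : X}, lt a b → lt b c → lt a c
  total : ∀ {a b : X}, a ≠ b → lt a b ∨ lt b a
  sbtw : ∀ {a b c : X}, lt a b → lt b c → sbtw a b c

namespace CircularCut

variable {X : Type*} [CircularOrder X]

theorem irrefl (p : CircularCut X) (a : X) : ¬ p.lt a a := fun h =>
  sbtw_irrefl_left_right (p.sbtw h h)

theorem asymm (p : CircularCut X) {a b : X} (h : p.lt a b) : ¬ p.lt b a := fun h' =>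
  p.irrefl _ (p.trans h h')

theorem rotation_of_sbtw (p : CircularCut X) {a b c : X} (h : SBtw.sbtw a b c) :
    p.lt a b ∧ p.lt b c ∧ p.lt a c ∨ p.lt b c ∧ p.lt c a ∧ p.lt b a ∨
      p.lt c a ∧ p.lt a b ∧ p.lt c b := by
  have hab : a ≠ b := by rintro rfl; exact sbtw_irrefl_left h
  have hbc : b ≠ c := by rintro rfl; exact sbtw_irrefl_right h
  have hca : c ≠ a := by rintro rfl; exact sbtw_irrefl_left_right h
  have key : ∀ {x y z : X}, SBtw.sbtw x y z → ¬ (p.lt z y ∧ p.lt y x) := fun h h' =>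
    sbtw_asymm h (p.sbtw h'.1 h'.2)
  have h1 := key h
  have h2 := key h.cyclic_left
  have h3 := key h.cyclic_right
  have t1 := @p.trans
  have := p.total hab
  have := p.total hbc
  have := p.total hca
  grind

theorem rotation (p q : CircularCut X) {a b c : X} (hab : p.lt a b) (hbc : p.lt b c) :
    q.lt a b ∧ q.lt b c ∧ q.lt a c ∨ q.lt b c ∧ q.lt c a ∧ q.lt b a ∨
      q.lt c a ∧ q.lt a b ∧ q.lt c b :=
  q.rotation_of_sbtw (p.sbtw hab hbc)

/-- `p.arc q` consists of the points passed when going from the cut `p` to the cut `q`. -/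
def arc (p q : CircularCut X) (a : X) : Prop := ∃ b, p.lt a b ∧ q.lt b a

theorem arc_of_lt {p q : CircularCut X} {a b : X} (hab : p.lt a b) (hb : p.arc q b) :
    p.arc q a := by
  obtain ⟨c, hbc, hcb⟩ := hb
  have := q.asymm hcb
  rcases p.rotation q hab hbc with h | h | h
  · tauto
  · exact ⟨b, hab, h.2.2⟩
  · exact ⟨c, p.trans hab hbc, h.1⟩

/-- The order of `q` arises from that of `p` by moving the initial segment `p.arc q` to the end, so
exactly the pairs separated by this segment are reversed. In particular `p` and the arc determine
`q`. -/
theorem lt_iff_of_lt {p : CircularCut X} (q : CircularCut X) {a b : X} (hab : p.lt a b) :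
    q.lt b a ↔ p.arc q a ∧ ¬ p.arc q b := by
  constructor
  · intro h
    refine ⟨⟨b, hab, h⟩, ?_⟩
    rintro ⟨c, hbc, hcb⟩
    have := q.asymm h
    have := q.asymm hcb
    rcases p.rotation q hab hbc with h | h | h <;> tauto
  · rintro ⟨⟨c, hac, hca⟩, hb⟩
    by_contra h
    have hne : a ≠ b := fun e => p.irrefl _ (e ▸ hab)
    have hab' : q.lt a b := (q.total hne).resolve_right h
    have hcb : q.lt c b := q.trans hca hab'
    have hne' : c ≠ b := fun e => q.irrefl _ (e ▸ hcb)
    rcases p.total hne' with h1 | h1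
    · have := q.asymm hca
      rcases p.rotation q hac h1 with h | h | h <;> tauto
    · exact hb ⟨c, h1, hcb⟩

theorem not_arc_self (p : CircularCut X) (a : X) : ¬ p.arc p a := fun ⟨_, h, h'⟩ => p.asymm h h'

theorem eq_of_lt_imp {p q : CircularCut X} (h : ∀ a b, p.lt a b → q.lt a b) : p = q := by
  ext a b
  refine ⟨h a b, fun hab => ?_⟩
  have hne : a ≠ b := fun e => q.irrefl _ (e ▸ hab)
  exact (p.total hne).resolve_right fun h' => q.asymm hab (h _ _ h')

theorem eq_of_arc_iff {p q r : CircularCut X} (h : ∀ a, p.arc q a ↔ p.arc r a) : q = r := by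
  refine eq_of_lt_imp fun a b hab => ?_
  have hne : a ≠ b := fun e => q.irrefl _ (e ▸ hab)
  rcases p.total hne with h1 | h1
  · refine (r.total hne).resolve_right fun h' => ?_
    rw [lt_iff_of_lt r h1, ← h, ← h, ← lt_iff_of_lt q h1] at h'
    exact q.asymm hab h'
  · rwa [lt_iff_of_lt r h1, ← h, ← h, ← lt_iff_of_lt q h1]

/-! ### The circular order on cuts -/

/-- The strict circular order of cuts: `x`, `y`, `z` separate the cuts `p`, `q`, `r`. -/
def SBtwCuts (p q r : CircularCut X) : Prop :=
  ∃ x y z, (p.lt x y ∧ p.lt y z) ∧ (q.lt y z ∧ q.lt z x) ∧ r.lt z x ∧ r.lt x y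

/-- Seen from `p`, cuts are initial segments of a linear order, hence nested. The relation says that
the segments of `p`, `q`, `r` and the whole of `X` increase strictly, which reduces the axioms to
inclusions. -/
theorem sbtwCuts_iff_arc {p q r : CircularCut X} : SBtwCuts p q r ↔
    (∃ x, p.arc q x) ∧ (∃ y, ¬ p.arc q y ∧ p.arc r y) ∧ ∃ z, ¬ p.arc r z := by
  constructor
  · rintro ⟨x, y, z, ⟨hp1, hp2⟩, ⟨hq1, hq2⟩, hr1, hr2⟩
    have h1 := (lt_iff_of_lt q hp1).1 (q.trans hq1 hq2)
    have h2 := (lt_iff_of_lt r hp2).1 (r.trans hr1 hr2)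
    exact ⟨⟨x, h1.1⟩, ⟨y, h1.2, h2.1⟩, z, h2.2⟩
  · rintro ⟨⟨x, hx⟩, ⟨y, hy, hy'⟩, z, hz⟩
    have hxy : p.lt x y := by
      refine (p.total (by rintro rfl; exact hy hx)).resolve_right fun h => hy (arc_of_lt h hx)
    have hyz : p.lt y z := by
      refine (p.total (by rintro rfl; exact hz hy')).resolve_right fun h => hz (arc_of_lt h hy')
    have h1 := (lt_iff_of_lt q hxy).2 ⟨hx, hy⟩
    have h2 := (lt_iff_of_lt r hyz).2 ⟨hy', hz⟩
    have a1 := q.asymm h1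
    have a2 := r.asymm h2
    refine ⟨x, y, z, ⟨hxy, hyz⟩, ?_, ?_⟩
    · have hz' : ¬ p.arc q z := fun h => hy (arc_of_lt hyz h)
      rcases p.rotation q hxy hyz with h | h | h
      · tauto
      · tauto
      · tauto
    · rcases p.rotation r hxy hyz with h | h | h <;> tauto

theorem SBtwCuts.cyclic {p q r : CircularCut X} : SBtwCuts p q r → SBtwCuts q r p :=
  fun ⟨x, y, z, hp, hq, hr⟩ => ⟨y, z, x, hq, hr, hp⟩

theorem SBtwCuts.asymm {p q r : CircularCut X} (h : SBtwCuts p q r) : ¬ SBtwCuts r q p := by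
  intro h'
  obtain ⟨-, ⟨y, hy, hy'⟩, -⟩ := sbtwCuts_iff_arc.1 h
  obtain ⟨-, ⟨z, hz, hz'⟩, -⟩ := sbtwCuts_iff_arc.1 h'.cyclic.cyclic
  rcases eq_or_ne y z with rfl | hne
  · exact hy hz'
  · rcases p.total hne with h1 | h1
    · exact hy (arc_of_lt h1 hz')
    · exact hz (arc_of_lt h1 hy')

theorem SBtwCuts.trans_left {p q r s : CircularCut X} (h : SBtwCuts p q r)
    (h' : SBtwCuts q s r) : SBtwCuts p s r := by
  obtain ⟨⟨x, hx⟩, ⟨y, hy, hy'⟩, z, hz⟩ := sbtwCuts_iff_arc.1 h.cyclic.cyclic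
  obtain ⟨⟨x', hx'⟩, ⟨y', hy1, hy2⟩, z', hz'⟩ := sbtwCuts_iff_arc.1 h'.cyclic.cyclic
  refine SBtwCuts.cyclic (sbtwCuts_iff_arc.2 ⟨⟨x, hx⟩, ⟨y, hy, ?_⟩, z', hz'⟩)
  rcases eq_or_ne y y' with rfl | hne
  · exact hy2
  · rcases r.total hne with h1 | h1
    · exact arc_of_lt h1 hy2
    · exact absurd (arc_of_lt h1 hy') hy1

theorem exists_arc_of_ne {p q : CircularCut X} (h : p ≠ q) : ∃ a, p.arc q a := by
  by_contra! h'
  exact h (eq_of_arc_iff fun a => iff_of_false (p.not_arc_self a) (h' a))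

theorem exists_not_arc {p q : CircularCut X} (h : p ≠ q) : ∃ a, ¬ p.arc q a := by
  obtain ⟨a, b, hab, hba⟩ := exists_arc_of_ne h
  exact ⟨b, ((lt_iff_of_lt q hab).1 hba).2⟩

theorem sbtwCuts_or_of_ne {p q r : CircularCut X} (hpq : p ≠ q) (hqr : q ≠ r) (hrp : r ≠ p) :
    SBtwCuts p q r ∨ SBtwCuts r q p := by
  by_cases h : ∃ y, ¬ p.arc q y ∧ p.arc r y
  · exact .inl (sbtwCuts_iff_arc.2 ⟨exists_arc_of_ne hpq, h, exists_not_arc hrp.symm⟩)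
  · by_cases h' : ∃ y, ¬ p.arc r y ∧ p.arc q y
    · exact .inr (SBtwCuts.cyclic
        (sbtwCuts_iff_arc.2 ⟨exists_arc_of_ne hrp.symm, h', exists_not_arc hpq⟩))
    · push Not at h h'
      exact absurd (eq_of_arc_iff fun a => ⟨fun h1 => not_not.1 fun h2 => h' a h2 h1,
        fun h1 => not_not.1 fun h2 => h a h2 h1⟩) hqr

instance : CircularOrder (CircularCut X) where
  btw p q r := ¬ SBtwCuts r q p
  sbtw := SBtwCuts
  btw_refl p h := h.asymm h
  btw_cyclic_left h h' := h h'.cyclic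
  sbtw_iff_btw_not_btw :=
    ⟨fun h => ⟨h.asymm, not_not.2 h⟩, fun h => not_not.1 h.2⟩
  sbtw_trans_left := SBtwCuts.trans_left
  btw_antisymm {p q r} h h' := by
    by_contra! hne
    rcases sbtwCuts_or_of_ne hne.1 hne.2.1 hne.2.2 with h1 | h1
    · exact h' h1
    · exact h h1
  btw_total p q r := by
    by_contra! h
    exact h.1.asymm h.2

theorem sbtw_iff {p q r : CircularCut X} : SBtw.sbtw p q r ↔
    ∃ x y z, (p.lt x y ∧ p.lt y z) ∧ (q.lt y z ∧ q.lt z x) ∧ r.lt z x ∧ r.lt x y := Iff.rfl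

theorem sbtw_iff_lt (p : CircularCut X) {a b c : X} : SBtw.sbtw a b c ↔
    p.lt a b ∧ p.lt b c ∨ p.lt b c ∧ p.lt c a ∨ p.lt c a ∧ p.lt a b := by
  constructor
  · intro h
    rcases p.rotation_of_sbtw h with h | h | h <;> tauto
  · rintro (h | h | h)
    · exact p.sbtw h.1 h.2
    · exact (p.sbtw h.1 h.2).cyclic_right
    · exact (p.sbtw h.1 h.2).cyclic_left

/-! ### Cuts adjacent to a point -/

/-- The cut immediately after the point `x`. -/
def after (x : X) : CircularCut X where
  lt a b := SBtw.sbtw a b x ∨ b = x ∧ a ≠ x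
  trans {a b c} := by
    rintro (h | ⟨rfl, h⟩) (h' | ⟨rfl, h'⟩)
    · exact .inl (h.trans_left h')
    · refine .inr ⟨rfl, ?_⟩
      rintro rfl
      exact sbtw_irrefl_left_right h
    · exact absurd h' sbtw_irrefl_left_right
    · exact absurd rfl h'
  total {a b} hab := by
    by_cases ha : a = x
    · exact .inr (.inr ⟨ha, fun hb => hab (ha.trans hb.symm)⟩)
    by_cases hb : b = x
    · exact .inl (.inr ⟨hb, ha⟩)
    rcases sbtw_or_sbtw_of_ne hab hb (Ne.symm ha) with h | h
    · exact .inl (.inl h)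
    · exact .inr (.inl h.cyclic_left)
  sbtw {a b c} := by
    rintro (h | ⟨rfl, h⟩) (h' | ⟨rfl, h'⟩)
    · exact (sbtw_trans_right h' h.cyclic_left).cyclic_right
    · exact h
    · exact absurd h' sbtw_irrefl_left_right
    · exact absurd rfl h'

/-- The cut immediately before the point `x`. -/
def before (x : X) : CircularCut X where
  lt a b := SBtw.sbtw x a b ∨ a = x ∧ b ≠ x
  trans {a b c} := by
    rintro (h | ⟨rfl, h⟩) (h' | ⟨rfl, h'⟩)
    · exact .inl (sbtw_trans_right h h')
    · exact absurd h sbtw_irrefl_left_right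
    · refine .inr ⟨rfl, ?_⟩
      rintro rfl
      exact sbtw_irrefl_left_right h'
    · exact absurd rfl h
  total {a b} hab := by
    by_cases ha : a = x
    · exact .inl (.inr ⟨ha, fun hb => hab (ha.trans hb.symm)⟩)
    by_cases hb : b = x
    · exact .inr (.inr ⟨hb, ha⟩)
    rcases sbtw_or_sbtw_of_ne hab hb (Ne.symm ha) with h | h
    · exact .inl (.inl h.cyclic_right)
    · exact .inr (.inl h)
  sbtw {a b c} := by
    rintro (h | ⟨rfl, h⟩) (h' | ⟨rfl, h'⟩)
    · exact (sbtw_trans_right h'.cyclic_left h.cyclic_right).cyclic_right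
    · exact absurd h sbtw_irrefl_left_right
    · exact h'
    · exact absurd rfl h

theorem lt_after {x a : X} (h : a ≠ x) : (after x).lt a x := .inr ⟨rfl, h⟩

theorem before_lt {x a : X} (h : a ≠ x) : (before x).lt x a := .inr ⟨rfl, h⟩

theorem eq_after {p : CircularCut X} {x : X} (h : ∀ a, a ≠ x → p.lt a x) : p = after x := by
  refine (eq_of_lt_imp ?_).symm
  rintro a b (h' | ⟨rfl, h'⟩)
  · have hb : b ≠ x := by rintro rfl; exact sbtw_irrefl_right h'
    have := p.asymm (h b hb)
    have ha : a ≠ x := by rintro rfl; exact sbtw_irrefl_left_right h'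
    have := p.asymm (h a ha)
    rcases p.rotation_of_sbtw h' with h | h | h <;> tauto
  · exact h a h'

theorem eq_before {p : CircularCut X} {x : X} (h : ∀ a, a ≠ x → p.lt x a) : p = before x := by
  refine (eq_of_lt_imp ?_).symm
  rintro a b (h' | ⟨rfl, h'⟩)
  · have ha : a ≠ x := by rintro rfl; exact sbtw_irrefl_left h'
    have := p.asymm (h a ha)
    have hb : b ≠ x := by rintro rfl; exact sbtw_irrefl_left_right h'
    have := p.asymm (h b hb)
    rcases p.rotation_of_sbtw h' with h | h | h <;> tauto
  · exact h b h'

/-- A cut reads `y` before `x` exactly when it lies on the way from `x` to `y`. This identifies the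
subbasic sets of the pointwise topology with complements of closed intervals. Density provides the
third point needed to witness a strict relation between cuts. -/
theorem lt_iff_notMem_circularClosedInterval
    (hd : ∀ (p : CircularCut X) (a b : X), p.lt a b → ∃ c, p.lt a c ∧ p.lt c b)
    {x y : X} (hxy : x ≠ y) (p : CircularCut X) :
    p.lt x y ↔ p ∉ circularClosedInterval (after x) (before y) := by
  constructor
  · rintro h (h' | rfl | rfl)
    · obtain ⟨w, hw, hw'⟩ := hd p x y h
      refine sbtw_asymm h' (sbtw_iff.2 ⟨y, x, w, ?_, ⟨hw, hw'⟩, ?_⟩)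
      · have hx := before_lt hxy
        have hy : w ≠ y := fun e => p.irrefl _ (e ▸ hw')
        have := (before y).asymm (before_lt hy)
        have := (before y).asymm hx
        rcases p.rotation (before y) hw hw' with h | h | h <;> tauto
      · have hx : w ≠ x := fun e => p.irrefl _ (e ▸ hw)
        have := (after x).asymm (lt_after hx)
        have := (after x).asymm (lt_after hxy.symm)
        rcases p.rotation (after x) hw hw' with h | h | h <;> tauto
    · exact (after x).asymm h (lt_after hxy.symm)
    · exact (before y).asymm h (before_lt hxy)
  · intro h
    by_contra hlt
    have hyx : p.lt y x := (p.total hxy).resolve_left hlt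
    refine h ?_
    by_cases h1 : ∀ a, a ≠ x → p.lt a x
    · exact .inr (.inl (eq_after h1))
    by_cases h2 : ∀ a, a ≠ y → p.lt y a
    · exact .inr (.inr (eq_before h2))
    push Not at h1 h2
    obtain ⟨u, hu, hu'⟩ := h1
    obtain ⟨v, hv, hv'⟩ := h2
    have hxu : p.lt x u := (p.total hu).resolve_left hu'
    have hvy : p.lt v y := (p.total hv).resolve_right hv'
    have hyu := p.trans hyx hxu
    have hvx := p.trans hvy hyx
    have hne : ∀ {a b}, p.lt a b → a ≠ b := fun hab e => p.irrefl _ (e ▸ hab)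
    left
    refine sbtw_iff.2 ⟨u, v, y, ?_, ⟨hvy, hyu⟩, ?_⟩
    · have a1 := (after x).asymm (lt_after (hne hvx))
      have a2 := (after x).asymm (lt_after (hne hxu).symm)
      have a3 := (after x).asymm (lt_after hxy.symm)
      have := p.rotation (after x) hvy hyx
      have := p.rotation (after x) hvx hxu
      have := p.rotation (after x) hvy hyu
      tauto
    · have a1 := (before y).asymm (before_lt (hne hvy))
      have a2 := (before y).asymm (before_lt (hne hyu).symm)
      rcases p.rotation (before y) hvy hyu with h | h | h <;> tauto

/-! ### The compact topology on cuts -/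

/-- The order relation of a cut as a Boolean function. -/
noncomputable def code (p : CircularCut X) (x : X × X) : Bool :=
  open Classical in decide (p.lt x.1 x.2)

theorem code_eq_true {p : CircularCut X} {x : X × X} : p.code x = true ↔ p.lt x.1 x.2 := by
  simp [code]

noncomputable instance : TopologicalSpace (CircularCut X) := .induced code inferInstance

theorem code_injective : Function.Injective (code (X := X)) := fun p q h => by
  ext a b
  rw [← code_eq_true (x := (a, b)), h, code_eq_true]

theorem continuous_code : Continuous (code (X := X)) := continuous_induced_dom

theorem isClopen_setOf_lt (a b : X) : IsClopen {p : CircularCut X | p.lt a b} := by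
  have : {p : CircularCut X | p.lt a b} = (fun p => p.code (a, b)) ⁻¹' {true} := by
    ext p; simp [code_eq_true]
  rw [this]
  exact (isClopen_discrete _).preimage ((continuous_apply _).comp continuous_code)

/-- Each axiom of a cut involves finitely many coordinates, so this description makes the range
closed. -/
theorem range_code : Set.range (code (X := X)) =
    {r | ∀ a b c, (r (a, b) = true → r (b, c) = true → r (a, c) = true ∧ SBtw.sbtw a b c) ∧
      (a ≠ b → r (a, b) = true ∨ r (b, a) = true)} := by
  ext r
  constructor
  · rintro ⟨p, rfl⟩ a b c
    simp only [code_eq_true]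
    exact ⟨fun h h' => ⟨p.trans h h', p.sbtw h h'⟩, p.total⟩
  · intro h
    refine ⟨⟨fun a b => r (a, b) = true, fun h1 h2 => ((h _ _ _).1 h1 h2).1,
      fun {a b} => (h a b a).2, fun h1 h2 => ((h _ _ _).1 h1 h2).2⟩, ?_⟩
    ext x
    simp [code]

theorem isClosedEmbedding_code : Topology.IsClosedEmbedding (code (X := X)) := by
  refine ⟨⟨⟨rfl⟩, code_injective⟩, ?_⟩
  have hc : ∀ x : X × X, IsClopen {r : X × X → Bool | r x = true} := fun x =>
    (isClopen_discrete {true}).preimage (continuous_apply x)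
  rw [range_code]
  simp only [Set.ofPred_forall]
  refine isClosed_iInter fun a => isClosed_iInter fun b => isClosed_iInter fun c => ?_
  refine IsClosed.inter ?_ ?_
  · exact isClosed_imp (hc _).isOpen (isClosed_imp (hc _).isOpen
      ((hc _).isClosed.inter isClosed_const))
  · exact isClosed_imp isOpen_const ((hc _).isClosed.union (hc _).isClosed)

instance : CompactSpace (CircularCut X) := isClosedEmbedding_code.compactSpace

instance : T2Space (CircularCut X) := isClosedEmbedding_code.isEmbedding.t2Space

theorem metrizableSpace [Countable X] : TopologicalSpace.MetrizableSpace (CircularCut X) :=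
  isClosedEmbedding_code.isEmbedding.metrizableSpace

theorem topology_eq_generateFrom : (inferInstance : TopologicalSpace (CircularCut X)) =
    .generateFrom {U | ∃ a b, a ≠ b ∧ U = {p : CircularCut X | p.lt a b}} := by
  refine le_antisymm (le_generateFrom ?_) ?_
  · rintro _ ⟨a, b, -, rfl⟩
    exact (isClopen_setOf_lt a b).isOpen
  · refine continuous_iff_le_induced.1 ?_
    let _ : TopologicalSpace (CircularCut X) :=
      .generateFrom {U | ∃ a b, a ≠ b ∧ U = {p : CircularCut X | p.lt a b}}
    have ho : ∀ a b, IsOpen {p : CircularCut X | p.lt a b} := fun a b => by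
      by_cases hab : a = b
      · subst hab
        simp [irrefl]
      · exact TopologicalSpace.isOpen_generateFrom_of_mem ⟨a, b, hab, rfl⟩
    refine continuous_pi fun x => ?_
    refine continuous_discrete_rng.2 fun b => ?_
    obtain ⟨c, d⟩ := x
    cases b
    · by_cases hcd : c = d
      · subst hcd
        have : (fun p : CircularCut X => p.code (c, c)) ⁻¹' {false} = Set.univ := by
          ext p; simp [code, irrefl]
        rw [this]; exact isOpen_univ
      · have : (fun p : CircularCut X => p.code (c, d)) ⁻¹' {false} = {p | p.lt d c} := by
          ext p
          simp only [code, Set.mem_preimage, Set.mem_singleton_iff, decide_eq_false_iff_not,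
            Set.mem_ofPred_eq]
          exact ⟨(p.total hcd).resolve_left, p.asymm⟩
        rw [this]; exact ho d c
    · have : (fun p : CircularCut X => p.code (c, d)) ⁻¹' {true} = {p | p.lt c d} := by
        ext p; simp [code_eq_true]
      rw [this]; exact ho c d

theorem isOpen_setOf_sbtw (p q : CircularCut X) : IsOpen {r | SBtw.sbtw p r q} := by
  have : {r | SBtw.sbtw p r q} = ⋃ (x : X) (y : X) (z : X) (_ : p.lt x y ∧ p.lt y z)
      (_ : q.lt z x ∧ q.lt x y), {r | r.lt y z} ∩ {r | r.lt z x} := by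
    ext r
    simp only [Set.mem_ofPred_eq, Set.mem_iUnion, sbtw_iff, Set.mem_inter_iff, exists_prop]
    exact exists_congr fun x => exists_congr fun y => exists_congr fun z => by tauto
  rw [this]
  exact isOpen_iUnion fun x => isOpen_iUnion fun y => isOpen_iUnion fun z => isOpen_iUnion fun _ =>
    isOpen_iUnion fun _ => (isClopen_setOf_lt _ _).isOpen.inter (isClopen_setOf_lt _ _).isOpen

theorem isOpen_compl_circularClosedInterval (p q : CircularCut X) :
    IsOpen (circularClosedInterval p q)ᶜ := by
  -- The degenerate interval is a single point, so its complement is not an open interval of the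
  -- form used below.
  rcases eq_or_ne p q with rfl | hpq
  · have : circularClosedInterval p p = {p} := by
      ext r; simp [circularClosedInterval, sbtw_irrefl_left_right]
    rw [this]
    exact isOpen_compl_singleton
  · have : (circularClosedInterval p q)ᶜ = {r | SBtw.sbtw q r p} := by
      ext r
      simp only [circularClosedInterval, Set.mem_compl_iff, Set.mem_union, Set.mem_ofPred_eq,
        Set.mem_insert_iff, Set.mem_singleton_iff, not_or]
      constructor
      · rintro ⟨h1, h2, h3⟩
        exact (sbtw_or_sbtw_of_ne (Ne.symm h2) h3 hpq.symm).resolve_left h1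
      · intro h
        refine ⟨sbtw_asymm h, ?_, ?_⟩
        · rintro rfl; exact sbtw_irrefl_right h
        · rintro rfl; exact sbtw_irrefl_left h
    rw [this]
    exact isOpen_setOf_sbtw q p

theorem topology_eq_circularIntervalTopology
    (hd : ∀ (p : CircularCut X) (a b : X), p.lt a b → ∃ c, p.lt a c ∧ p.lt c b) :
    (inferInstance : TopologicalSpace (CircularCut X)) =
      circularIntervalTopology (CircularCut X) := by
  refine le_antisymm (le_generateFrom ?_) ?_
  · rintro _ ⟨p, q, rfl⟩
    exact isOpen_compl_circularClosedInterval p q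
  · rw [topology_eq_generateFrom]
    refine le_generateFrom ?_
    rintro _ ⟨a, b, hab, rfl⟩
    refine TopologicalSpace.isOpen_generateFrom_of_mem ⟨after a, before b, ?_⟩
    ext p
    exact lt_iff_notMem_circularClosedInterval hd hab p

end CircularCut

/-! ### The pointwise topology on the group -/

theorem isOpen_setOf_smul_eq {G X : Type*} [Group G] [MulAction G X] [TopologicalSpace G]
    (ht : (inferInstance : TopologicalSpace G) = pointwiseTopology G X) (x y : X) :
    IsOpen {g : G | g • x = y} := by
  let _ : TopologicalSpace X := ⊥
  have : DiscreteTopology X := ⟨rfl⟩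
  have hc : Continuous fun (g : G) (x : X) => g • x := by
    have : @Continuous G _ (pointwiseTopology G X) _ fun (g : G) (x : X) => g • x :=
      continuous_induced_dom
    rwa [← ht] at this
  exact (isOpen_discrete {y}).preimage ((continuous_apply x).comp hc)

theorem exists_finset_of_mem_nhds_one {G X : Type*} [Group G] [MulAction G X] [TopologicalSpace G]
    (ht : (inferInstance : TopologicalSpace G) = pointwiseTopology G X) {s : Set G}
    (hs : s ∈ nhds (1 : G)) : ∃ F : Finset X, ∀ g : G, (∀ a ∈ F, g • a = a) → g ∈ s := by
  let _ : TopologicalSpace X := ⊥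
  have ht' : (inferInstance : TopologicalSpace G) =
    .induced (fun (g : G) (x : X) => g • x) inferInstance := ht
  have : nhds (1 : G) = _ := ht' ▸ nhds_induced _ _
  rw [this, Filter.mem_comap] at hs
  obtain ⟨t, ht, hts⟩ := hs
  rw [nhds_pi, Filter.mem_pi] at ht
  obtain ⟨I, hI, v, hv, hvt⟩ := ht
  refine ⟨hI.toFinset, fun g hg => hts (hvt fun x hx => ?_)⟩
  have := mem_of_mem_nhds (hv x)
  rw [one_smul] at this
  change g • x ∈ v x
  rwa [hg x (by simpa using hx)]

/-! ### Moving finite sets by ultrahomogeneity -/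

namespace CircularCut

variable {G X : Type*} [Group G] [MulAction G X] [CircularOrder X]

theorem exists_equiv_of_card_eq {α β : Type*} [CircularOrder α] [CircularOrder β]
    (p : CircularCut α) (q : CircularCut β) (A : Finset α) (B : Finset β) (h : A.card = B.card) :
    ∃ e : A ≃ B, ∀ a b : A, p.lt a b ↔ q.lt (e a) (e b) := by
  classical
  have hα : IsStrictTotalOrder α p.lt :=
    { trichotomous := fun a b h h' => by_contra fun hab => (p.total hab).elim h h'
      irrefl := p.irrefl
      trans := fun _ _ _ => p.trans }
  have hβ : IsStrictTotalOrder β q.lt :=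
    { trichotomous := fun a b h h' => by_contra fun hab => (q.total hab).elim h h'
      irrefl := q.irrefl
      trans := fun _ _ _ => q.trans }
  let _ : LinearOrder α := linearOrderOfSTO p.lt
  let _ : LinearOrder β := linearOrderOfSTO q.lt
  let e : A ≃o B := (A.orderIsoOfFin rfl).symm.trans (B.orderIsoOfFin h.symm)
  exact ⟨e.toEquiv, fun a b => (e.lt_iff_lt (x := a) (y := b)).symm⟩

theorem eq_of_forall_lt_iff {α : Type*} [CircularOrder α] (p : CircularCut α) {β : Type*}
    [CircularOrder β] (q : CircularCut β) (A : Finset α) (f g : α → β)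
    (hf : ∀ a ∈ A, ∀ b ∈ A, p.lt a b ↔ q.lt (f a) (f b))
    (hg : ∀ a ∈ A, ∀ b ∈ A, p.lt a b ↔ q.lt (g a) (g b))
    (hfg : f '' A = g '' A) : ∀ a ∈ A, f a = g a := by
  classical
  have hα : IsStrictTotalOrder α p.lt :=
    { trichotomous := fun a b h h' => by_contra fun hab => (p.total hab).elim h h'
      irrefl := p.irrefl
      trans := fun _ _ _ => p.trans }
  have hβ : IsStrictTotalOrder β q.lt :=
    { trichotomous := fun a b h h' => by_contra fun hab => (q.total hab).elim h h'
      irrefl := q.irrefl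
      trans := fun _ _ _ => q.trans }
  let _ : LinearOrder α := linearOrderOfSTO p.lt
  let _ : LinearOrder β := linearOrderOfSTO q.lt
  have hf' : StrictMono fun a : A => f a := fun a b h => (hf a a.2 b b.2).1 h
  have hg' : StrictMono fun a : A => g a := fun a b h => (hg a a.2 b b.2).1 h
  have := (StrictMono.range_inj hf' hg').1 (by
    rw [Set.image_eq_range, Set.image_eq_range] at hfg; exact hfg)
  exact fun a ha => congrFun this ⟨a, ha⟩

/-- Finite linear orders of equal size are isomorphic, and since any cut determines the circular
order, such an isomorphism extends to an element of `G`. -/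
theorem exists_smul_of_infinite (hX : IsUltrahomogeneousAction G X) (p q : CircularCut X)
    (F : Finset X) {S : Set X} (hS : S.Infinite) :
    ∃ g : G, (∀ a ∈ F, g • a ∈ S) ∧ ∀ a ∈ F, ∀ b ∈ F, p.lt a b ↔ q.lt (g • a) (g • b) := by
  obtain ⟨T, hTS, hT⟩ := hS.exists_subset_card_eq F.card
  obtain ⟨e, he⟩ := exists_equiv_of_card_eq p q F T hT.symm
  obtain ⟨g, hg⟩ := hX.extend F T e fun a b c => by
    rw [sbtw_iff_lt p, sbtw_iff_lt q, he, he, he]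
  refine ⟨g, fun a ha => ?_, fun a ha b hb => ?_⟩
  · rw [hg ⟨a, ha⟩]; exact hTS (e _).2
  · rw [hg ⟨a, ha⟩, hg ⟨b, hb⟩]; exact he ⟨a, ha⟩ ⟨b, hb⟩

theorem exists_smul_of_card_eq (hX : IsUltrahomogeneousAction G X) (p q : CircularCut X)
    (A B : Finset X) (h : A.card = B.card) :
    ∃ g : G, (fun x => g • x) '' (A : Set X) = (B : Set X) ∧
      ∀ a ∈ A, ∀ b ∈ A, p.lt a b ↔ q.lt (g • a) (g • b) := by
  obtain ⟨e, he⟩ := exists_equiv_of_card_eq p q A B h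
  obtain ⟨g, hg⟩ := hX.extend A B e fun a b c => by
    rw [sbtw_iff_lt p, sbtw_iff_lt q, he, he, he]
  refine ⟨g, ?_, fun a ha b hb => ?_⟩
  · ext y
    constructor
    · rintro ⟨a, ha, rfl⟩
      change g • a ∈ _
      rw [hg ⟨a, ha⟩]; exact (e _).2
    · intro hy
      refine ⟨e.symm ⟨y, hy⟩, (e.symm _).2, ?_⟩
      change g • _ = _
      rw [hg, e.apply_symm_apply]
  · rw [hg ⟨a, ha⟩, hg ⟨b, hb⟩]; exact he ⟨a, ha⟩ ⟨b, hb⟩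

/-- Some three points satisfy `u < v < w`; moving `u`, `w` to `a`, `b` puts the image of `v` in
between. -/
theorem exists_lt_lt [Infinite X] (hX : IsUltrahomogeneousAction G X) (p : CircularCut X)
    {a b : X} (hab : p.lt a b) : ∃ c, p.lt a c ∧ p.lt c b := by
  classical
  obtain ⟨T, -, hT⟩ := (Set.infinite_univ (α := X)).exists_subset_card_eq 3
  obtain ⟨u, v, w, huv, hvw⟩ : ∃ u v w, p.lt u v ∧ p.lt v w := by
    obtain ⟨u, v, w, h1, h2, h3, -⟩ := Finset.card_eq_three.1 hT
    have t1 := @p.trans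
    have := p.total h1
    have := p.total h2
    have := p.total h3
    grind
  have huw := p.trans huv hvw
  have hne : ∀ {a b}, p.lt a b → a ≠ b := fun hab e => p.irrefl _ (e ▸ hab)
  obtain ⟨g, hg, hg'⟩ := exists_smul_of_card_eq hX p p {u, w} {a, b}
    ((Finset.card_pair (hne huw)).trans (Finset.card_pair (hne hab)).symm)
  have h := (hg' u (by simp) w (by simp)).1 huw
  have hu : g • u ∈ ((({a, b} : Finset X)) : Set X) := hg ▸ ⟨u, by simp, rfl⟩
  have hw : g • w ∈ ((({a, b} : Finset X)) : Set X) := hg ▸ ⟨w, by simp, rfl⟩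
  have hba := p.asymm hab
  have haa := p.irrefl a
  have hbb := p.irrefl b
  simp only [Finset.coe_insert, Finset.coe_singleton, Set.mem_insert_iff,
    Set.mem_singleton_iff] at hu hw
  have hs := hX.preserves g u v w (p.sbtw huv hvw)
  have : g • u = a ∧ g • w = b := by
    rcases hu with hu | hu <;> rcases hw with hw | hw <;> rw [hu, hw] at h <;> tauto
  rw [this.1, this.2] at hs
  rcases p.rotation_of_sbtw hs with h | h | h
  · exact ⟨_, h.1, h.2.1⟩
  · exact absurd h.2.1 hba
  · exact absurd h.1 hba

/-! ### The action on cuts: continuity, minimality, rigidity -/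

section Action

variable [hG : Fact (PreservesCircularOrder G X)]

instance : MulAction G (CircularCut X) where
  smul g p :=
    { lt := fun a b => p.lt (g⁻¹ • a) (g⁻¹ • b)
      trans := p.trans
      total := fun h => p.total fun h' => h (smul_left_cancel _ h')
      sbtw := fun h h' => by
        simpa using hG.out g _ _ _ (p.sbtw h h') }
  one_smul p := by
    ext a b
    change p.lt _ _ ↔ _
    simp
  mul_smul g h p := by
    ext a b
    change p.lt _ _ ↔ p.lt _ _
    simp [mul_smul]

theorem smul_lt {g : G} {p : CircularCut X} {a b : X} :
    (g • p).lt a b ↔ p.lt (g⁻¹ • a) (g⁻¹ • b) := Iff.rfl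

theorem smul_lt_smul {g : G} {p : CircularCut X} {a b : X} :
    (g • p).lt (g • a) (g • b) ↔ p.lt a b := by
  simp [smul_lt]

theorem preservesCircularOrder : PreservesCircularOrder G (CircularCut X) := by
  rintro g p q r ⟨x, y, z, h⟩
  refine ⟨g • x, g • y, g • z, ?_⟩
  simpa only [smul_lt_smul] using h

theorem smul_after (g : G) (x : X) : g • after x = after (g • x) := by
  refine eq_after fun a ha => ?_
  have : (g • after x).lt (g • g⁻¹ • a) (g • x) :=
    smul_lt_smul.2 (lt_after fun h => ha (by rw [← h, smul_inv_smul]))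
  rwa [smul_inv_smul] at this

theorem smul_before (g : G) (x : X) : g • before x = before (g • x) := by
  refine eq_before fun a ha => ?_
  have : (g • before x).lt (g • x) (g • g⁻¹ • a) :=
    smul_lt_smul.2 (before_lt fun h => ha (by rw [← h, smul_inv_smul]))
  rwa [smul_inv_smul] at this

theorem mem_nhds_iff {p : CircularCut X} {s : Set (CircularCut X)} :
    s ∈ nhds p ↔ ∃ F : Finset X,
      {q : CircularCut X | ∀ a ∈ F, ∀ b ∈ F, p.lt a b ↔ q.lt a b} ⊆ s := by
  classical
  constructor
  · rw [nhds_induced, Filter.mem_comap]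
    rintro ⟨t, ht, hts⟩
    rw [nhds_pi, Filter.mem_pi] at ht
    obtain ⟨I, hI, v, hv, hvt⟩ := ht
    refine ⟨hI.toFinset.image Prod.fst ∪ hI.toFinset.image Prod.snd, fun q hq => hts (hvt ?_)⟩
    intro x hx
    have : q.code x = p.code x := by
      rw [Bool.eq_iff_iff, code_eq_true, code_eq_true]
      refine (hq _ ?_ _ ?_).symm
      · exact Finset.mem_union_left _ (Finset.mem_image_of_mem _ (by simpa using hx))
      · exact Finset.mem_union_right _ (Finset.mem_image_of_mem _ (by simpa using hx))
    rw [this]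
    exact mem_of_mem_nhds (hv x)
  · rintro ⟨F, hF⟩
    refine Filter.mem_of_superset ?_ hF
    have : {q : CircularCut X | ∀ a ∈ F, ∀ b ∈ F, p.lt a b ↔ q.lt a b} =
        ⋂ a ∈ F, ⋂ b ∈ F, {q | p.lt a b ↔ q.lt a b} := by
      ext q; simp
    rw [this, Filter.biInter_finset_mem]
    intro a _
    rw [Filter.biInter_finset_mem]
    intro b _
    by_cases h : p.lt a b
    · simp only [h, true_iff]
      exact (isClopen_setOf_lt a b).isOpen.mem_nhds h
    · simp only [h, false_iff]
      exact (isClopen_setOf_lt a b).compl.isOpen.mem_nhds h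

theorem isMinimal [Infinite X] (hX : IsUltrahomogeneousAction G X) :
    MulAction.IsMinimal G (CircularCut X) := by
  refine ⟨fun q p => mem_closure_iff_nhds.2 fun s hs => ?_⟩
  obtain ⟨F, hF⟩ := mem_nhds_iff.1 hs
  obtain ⟨g, -, hg⟩ := exists_smul_of_infinite hX p q F Set.infinite_univ
  exact ⟨g⁻¹ • q, hF fun a ha b hb => by rw [hg a ha b hb, smul_lt, inv_inv], g⁻¹, rfl⟩

theorem continuousSMul [TopologicalSpace G]
    (ht : (inferInstance : TopologicalSpace G) = pointwiseTopology G X) :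
    ContinuousSMul G (CircularCut X) := by
  classical
  refine ⟨continuous_iff_continuousAt.2 fun ⟨g, p⟩ s hs => ?_⟩
  obtain ⟨F, hF⟩ := mem_nhds_iff.1 hs
  have h1 : ⋂ a ∈ F, {h : G | h • g⁻¹ • a = a} ∈ nhds g := by
    rw [Filter.biInter_finset_mem]
    exact fun a _ => (isOpen_setOf_smul_eq ht _ _).mem_nhds (smul_inv_smul g a)
  have h2 : {q : CircularCut X | ∀ a ∈ F.image (g⁻¹ • ·), ∀ b ∈ F.image (g⁻¹ • ·),
      p.lt a b ↔ q.lt a b} ∈ nhds p := mem_nhds_iff.2 ⟨_, subset_rfl⟩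
  refine Filter.mem_map.2 (Filter.mem_of_superset (prod_mem_nhds h1 h2) ?_)
  rintro ⟨h, q⟩ ⟨hh, hq⟩
  refine hF fun a ha b hb => ?_
  simp only [Set.mem_iInter, Set.mem_ofPred_eq] at hh
  have ea : h⁻¹ • a = g⁻¹ • a := by rw [inv_smul_eq_iff, hh a ha]
  have eb : h⁻¹ • b = g⁻¹ • b := by rw [inv_smul_eq_iff, hh b hb]
  rw [smul_lt, smul_lt, ea, eb]
  exact hq _ (Finset.mem_image_of_mem _ ha) _ (Finset.mem_image_of_mem _ hb)

theorem isMinimalSystem [Infinite X] [TopologicalSpace G] (hX : IsUltrahomogeneousAction G X)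
    (ht : (inferInstance : TopologicalSpace G) = pointwiseTopology G X) :
    IsMinimalSystem G (CircularCut X) where
  compact := inferInstance
  hausdorff := inferInstance
  nonempty := ⟨after (Classical.arbitrary X)⟩
  continuous_action := continuousSMul ht
  minimal := isMinimal hX

/-- The stabilizer of `x` fixes the image cut and is transitive on the points other than `x`, so in
that cut either all of them precede `x` or all follow it. -/
theorem equivariant_after_eq [Infinite X] (hX : IsUltrahomogeneousAction G X)
    (f : CircularCut X →[G] CircularCut X) (x : X) :
    f (after x) = after x ∨ f (after x) = before x := by
  have hfix : ∀ g : G, g • x = x → g • f (after x) = f (after x) := fun g hg => by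
    rw [← map_smul, smul_after, hg]
  by_contra! h
  have h1 : ∃ a, a ≠ x ∧ ¬ (f (after x)).lt a x := by
    by_contra! h'; exact h.1 (eq_after h')
  have h2 : ∃ a, a ≠ x ∧ ¬ (f (after x)).lt x a := by
    by_contra! h'; exact h.2 (eq_before h')
  obtain ⟨b, hb, hb'⟩ := h1
  obtain ⟨a, ha, ha'⟩ := h2
  have hxb := ((f (after x)).total hb).resolve_left hb'
  have hax := ((f (after x)).total ha).resolve_right ha'
  classical
  obtain ⟨g, hg, hg'⟩ := exists_smul_of_card_eq hX (after x) (after x) {a, x} {b, x}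
    ((Finset.card_pair ha).trans (Finset.card_pair hb).symm)
  have h := (hg' a (by simp) x (by simp)).1 (lt_after ha)
  have hu : g • a ∈ ((({b, x} : Finset X)) : Set X) := hg ▸ ⟨a, by simp, rfl⟩
  have hw : g • x ∈ ((({b, x} : Finset X)) : Set X) := hg ▸ ⟨x, by simp, rfl⟩
  have hba := (after x).asymm (lt_after hb)
  have haa := (after x).irrefl x
  have hbb := (after x).irrefl b
  simp only [Finset.coe_insert, Finset.coe_singleton, Set.mem_insert_iff,
    Set.mem_singleton_iff] at hu hw
  have : g • a = b ∧ g • x = x := by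
    rcases hu with hu | hu <;> rcases hw with hw | hw <;> rw [hu, hw] at h <;> tauto
  have hlt := smul_lt_smul (g := g).2 hax
  rw [hfix g this.2, this.1, this.2] at hlt
  exact hb' hlt

/-- Otherwise, by equivariance, `after t` goes to `before t` for each `t` in the orbit of `x`.
Choose `t ≠ x` with `after t` close to `after x`. Continuity makes `before t` read `x` before `a`,
as `before x` does; but `after t` reads `a` before `x`, and so does `before t`, since the two differ
only in the place of `t`. -/
theorem equivariant_after_ne_before [Infinite X] (hX : IsUltrahomogeneousAction G X)
    (f : CircularCut X →[G] CircularCut X) (hf : Continuous f) (x : X) :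
    f (after x) ≠ before x := by
  classical
  intro h
  have hg : ∀ g : G, f (after (g • x)) = before (g • x) := fun g => by
    rw [← smul_after, map_smul, h, smul_before]
  obtain ⟨a, ha⟩ := exists_ne x
  have hU : {p : CircularCut X | p.lt x a} ∈ nhds (f (after x)) :=
    (isClopen_setOf_lt x a).isOpen.mem_nhds (h ▸ before_lt ha)
  obtain ⟨F, hF⟩ := mem_nhds_iff.1 (hf.continuousAt hU)
  -- The element `g` moves the finite set off `x` preserving its order; then `t = g⁻¹ • x` lies
  -- outside that set.
  obtain ⟨g, hgS, hglt⟩ := exists_smul_of_infinite hX (after x) (after x) (insert x (insert a F))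
    (Set.finite_singleton x).infinite_compl
  have hlt : ∀ b ∈ insert x (insert a F), ∀ c ∈ insert x (insert a F),
      (after x).lt b c ↔ (after (g⁻¹ • x)).lt b c := fun b hb c hc => by
    rw [hglt b hb c hc, ← smul_after, smul_lt, inv_inv]
  have hm : (f (after (g⁻¹ • x))).lt x a := by
    have hmem : after (g⁻¹ • x) ∈ f ⁻¹' {p | p.lt x a} :=
      hF fun b hb c hc => hlt b (by simp [hb]) c (by simp [hc])
    exact hmem
  rw [hg] at hm
  have hax := (hlt a (by simp) x (by simp)).1 (lt_after ha)
  have htx : g⁻¹ • x ≠ x := by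
    intro e
    refine hgS x (by simp) ?_
    rw [Set.mem_singleton_iff]
    nth_rw 1 [← e]
    exact smul_inv_smul g x
  generalize g⁻¹ • x = t at *
  have hat : a ≠ t := by
    rintro rfl
    exact (after a).asymm hax (lt_after htx.symm)
  rcases hm with hm | ⟨h1, -⟩
  · rcases hax with h3 | ⟨h3, -⟩
    · exact sbtw_asymm hm h3
    · exact htx h3.symm
  · exact htx h1.symm

theorem equivariant_eq_id [Infinite X] (hX : IsUltrahomogeneousAction G X)
    (f : CircularCut X →[G] CircularCut X) (hf : Continuous f) (p : CircularCut X) : f p = p := by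
  obtain ⟨x⟩ : Nonempty X := inferInstance
  have := isMinimal hX
  have hfx : f (after x) = after x :=
    (equivariant_after_eq hX f x).resolve_right (equivariant_after_ne_before hX f hf x)
  refine congrFun (Continuous.ext_on (MulAction.dense_orbit G (after x)) hf continuous_id ?_) p
  rintro _ ⟨g, rfl⟩
  change f (g • after x) = g • after x
  rw [map_smul, hfx]

end Action

end CircularCut

/-! ### Ramsey's theorem -/

/-- The infinite Ramsey theorem for colourings of the `n`-element subsets of a set. -/
theorem exists_infinite_homogeneous {α κ : Type*} [Finite κ] (n : ℕ) (c : Finset α → κ)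
    {S : Set α} (hS : S.Infinite) :
    ∃ T ⊆ S, T.Infinite ∧ ∃ k, ∀ A : Finset α, (A : Set α) ⊆ T → A.card = n → c A = k := by
  classical
  induction n generalizing c S with
  | zero =>
    exact ⟨S, subset_rfl, hS, c ∅, fun A _ hA => by rw [Finset.card_eq_zero.1 hA]⟩
  | succ n ih =>
    -- Pick a point `x` and thin out the rest so that the colour of a set with first element `x`
    -- depends on `x` only. Iterating and applying the pigeonhole principle to these colours gives
    -- the homogeneous set.
    have step : ∀ S : {S : Set α // S.Infinite}, ∃ (x : α) (T : {S : Set α // S.Infinite}) (k : κ),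
        x ∈ S.1 ∧ T.1 ⊆ S.1 ∧ x ∉ T.1 ∧
          ∀ A : Finset α, (A : Set α) ⊆ T → A.card = n → c (insert x A) = k := by
      rintro ⟨S, hS⟩
      obtain ⟨x, hx⟩ := hS.nonempty
      obtain ⟨T, hT, hT', k, hk⟩ := ih (fun A => c (insert x A)) (hS.sdiff (Set.finite_singleton x))
      exact ⟨x, ⟨T, hT'⟩, k, hx, fun y hy => (hT hy).1, fun h => (hT h).2 rfl, hk⟩
    choose x next k hx hnext hxn hk using step
    let Q : ℕ → {S : Set α // S.Infinite} := fun m => next^[m] ⟨S, hS⟩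
    have hQ : ∀ m, Q (m + 1) = next (Q m) := fun m => Function.iterate_succ_apply' _ _ _
    have hanti : Antitone fun m => (Q m).1 := antitone_nat_of_succ_le fun m => by
      rw [hQ]; exact hnext _
    have hmem : ∀ {i j}, i < j → x (Q j) ∈ (next (Q i)).1 := fun {i j} hij => by
      rw [← hQ]; exact hanti (Nat.succ_le_of_lt hij) (hx _)
    have hinj : Function.Injective fun m => x (Q m) := by
      have hne : ∀ i j, i < j → x (Q i) ≠ x (Q j) := fun i j hij h => by
        have := hmem hij
        rw [← h] at this
        exact hxn _ this
      intro i j h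
      rcases lt_trichotomy i j with hij | hij | hij
      · exact absurd h (hne _ _ hij)
      · exact hij
      · exact absurd h.symm (hne _ _ hij)
    obtain ⟨k₀, hk₀⟩ := Finite.exists_infinite_fiber fun m => k (Q m)
    rw [Set.infinite_coe_iff] at hk₀
    refine ⟨(fun m => x (Q m)) '' ((fun m => k (Q m)) ⁻¹' {k₀}), ?_,
      hk₀.image hinj.injOn, k₀, fun A hA hcard => ?_⟩
    · rintro _ ⟨m, -, rfl⟩
      exact hanti (Nat.zero_le m) (hx (Q m))
    have hex : ∃ m, x (Q m) ∈ A := by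
      obtain ⟨a, ha⟩ := Finset.card_pos.1 (by rw [hcard]; exact n.succ_pos)
      obtain ⟨m, -, rfl⟩ := hA ha
      exact ⟨m, ha⟩
    have hmA := Nat.find_spec hex
    have hmin := fun i => Nat.find_min' hex (m := i)
    generalize Nat.find hex = m at hmA hmin
    obtain ⟨m', hm', he⟩ := hA hmA
    obtain rfl := hinj he
    rw [← Finset.insert_erase hmA, ← show k (Q m') = k₀ from hm']
    refine hk _ _ ?_ (by rw [Finset.card_erase_of_mem hmA, hcard, Nat.add_sub_cancel])
    intro a ha
    rw [Finset.coe_erase] at ha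
    obtain ⟨j, -, rfl⟩ := hA ha.1
    exact hmem (lt_of_le_of_ne (hmin j ha.1) fun e => ha.2 (by rw [e]; rfl))

/-- Ramsey's theorem for finitely many colourings simultaneously. -/
theorem exists_infinite_homogeneous_finset {α ι : Type*} [Infinite α] {κ : ι → Type*}
    [∀ i, Finite (κ i)] (n : ι → ℕ) (c : ∀ i, Finset α → κ i) (s : Finset ι) :
    ∃ T : Set α, T.Infinite ∧ ∀ i ∈ s, ∃ k, ∀ A : Finset α, (A : Set α) ⊆ T → A.card = n i →
      c i A = k := by
  classical
  induction s using Finset.induction_on with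
  | empty => exact ⟨Set.univ, Set.infinite_univ, by simp⟩
  | insert i s _ ih =>
    obtain ⟨S, hS, hc⟩ := ih
    obtain ⟨T, hTS, hT, k, hk⟩ := exists_infinite_homogeneous (n i) (c i) hS
    refine ⟨T, hT, fun j hj => ?_⟩
    rcases Finset.mem_insert.1 hj with rfl | hj
    · exact ⟨k, hk⟩
    · obtain ⟨k', hk'⟩ := hc j hj
      exact ⟨k', fun A hA => hk' A (hA.trans hTS)⟩

/-! ### Extension by continuity and equicontinuity -/

open scoped Uniformity

/-- A map with Cauchy germs along a map `j` with dense range extends continuously. -/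
theorem exists_continuous_extension {α M Y : Type*} [TopologicalSpace M] [UniformSpace Y]
    [CompactSpace Y] [T2Space Y] (j : α → M) (hj : DenseRange j) (f : α → Y)
    (hf : ∀ b, ∀ V ∈ 𝓤 Y, ∃ s ∈ nhds b, ∀ a a', j a ∈ s → j a' ∈ s → (f a, f a') ∈ V) :
    ∃ φ : M → Y, Continuous φ ∧ ∀ a, φ (j a) = f a := by
  let _ : TopologicalSpace α := .induced j inferInstance
  have di : IsDenseInducing j := ⟨⟨rfl⟩, hj⟩
  have key : ∀ b, ∃ c, Filter.Tendsto f (Filter.comap j (nhds b)) (nhds c) := fun b => by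
    have := di.comap_nhds_neBot b
    refine cauchy_map_iff_exists_tendsto.1 ?_
    refine cauchy_iff.2 ⟨inferInstance, fun V hV => ?_⟩
    obtain ⟨s, hs, h⟩ := hf b V hV
    refine ⟨f '' (j ⁻¹' s), Filter.image_mem_map (Filter.preimage_mem_comap hs), ?_⟩
    rintro ⟨_, _⟩ ⟨⟨a, ha, rfl⟩, a', ha', rfl⟩
    exact h a a' ha ha'
  refine ⟨di.extend f, di.continuous_extend key, fun a => ?_⟩
  obtain ⟨c, hc⟩ := key (j a)
  rw [← di.nhds_eq_comap] at hc
  exact di.extend_eq_at' c hc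

/-- By compactness of `Y`, a neighbourhood of the identity moves all points by little at once, and
it contains the pointwise stabilizer of a finite set. -/
theorem exists_finset_uniformly_small {G X Y : Type*} [Group G] [MulAction G X]
    [TopologicalSpace G] (ht : (inferInstance : TopologicalSpace G) = pointwiseTopology G X)
    [UniformSpace Y] [CompactSpace Y] [MulAction G Y] [ContinuousSMul G Y] {U : Set (Y × Y)}
    (hU : U ∈ 𝓤 Y) :
    ∃ F : Finset X, ∀ v : G, (∀ a ∈ F, v • a = a) → ∀ y : Y, (y, v • y) ∈ U := by
  have h : ∀ᶠ v in nhds (1 : G), ∀ y ∈ Set.univ, (y, v • y) ∈ U := by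
    refine isCompact_univ.eventually_forall_of_forall_eventually fun y _ => ?_
    have hc : ContinuousAt (fun z : G × Y => (z.2, z.1 • z.2)) (1, y) := by fun_prop
    have hU' : U ∈ nhds (y, (1 : G) • y) := by
      rw [one_smul]
      exact nhds_le_uniformity y hU
    exact hc hU'
  obtain ⟨F, hF⟩ := exists_finset_of_mem_nhds_one ht h
  exact ⟨F, fun v hv y => hF v hv y trivial⟩

/-! ### Universality of the system of cuts -/

namespace CircularCut

variable {G X : Type*} [Group G] [MulAction G X] [CircularOrder X]
  {Y : Type*} [UniformSpace Y] [CompactSpace Y] [MulAction G Y]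

/-- A finite colouring of the finite sets `A` that records, up to a small error, the position of
`g • y₀` for the elements `g` carrying `A` monotonically onto `F`. -/
theorem exists_coloring (p q : CircularCut X) (y₀ : Y) {U V : Set (Y × Y)} (hU : U ∈ 𝓤 Y)
    (hV : ∀ a b c d e, (a, b) ∈ U → (b, c) ∈ U → (d, c) ∈ U → (e, d) ∈ U → (a, e) ∈ V)
    {F : Finset X} (hF : ∀ v : G, (∀ a ∈ F, v • a = a) → ∀ y : Y, (y, v • y) ∈ U) :
    ∃ (κ : Set Y) (_ : Finite κ) (c : Finset X → κ), ∀ (A A' : Finset X) (g g' : G), c A = c A' →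
      (fun x => g • x) '' (A : Set X) = (F : Set X) →
      (∀ a ∈ A, ∀ b ∈ A, p.lt a b ↔ q.lt (g • a) (g • b)) →
      (fun x => g' • x) '' (A' : Set X) = (F : Set X) →
      (∀ a ∈ A', ∀ b ∈ A', p.lt a b ↔ q.lt (g' • a) (g' • b)) → (g • y₀, g' • y₀) ∈ V := by
  classical
  obtain ⟨t, ht, htU⟩ := isCompact_univ.totallyBounded U hU
  have hcov : ∀ y, ∃ x : t, (y, x.1) ∈ U := fun y => by
    have := htU (Set.mem_univ y)
    simp only [Set.mem_iUnion] at this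
    obtain ⟨x, hx, h⟩ := this
    exact ⟨⟨x, hx⟩, h⟩
  choose r hr using hcov
  let P : Finset X → G → Prop := fun A g => (fun x => g • x) '' (A : Set X) = (F : Set X) ∧
    ∀ a ∈ A, ∀ b ∈ A, p.lt a b ↔ q.lt (g • a) (g • b)
  -- Two monotone maps of `A` onto `F` coincide on `A`, so `h * g⁻¹` fixes `F` pointwise. Hence the
  -- point of the finite net `t` chosen for `A` hardly depends on `g`.
  have hP : ∀ A g h, P A g → P A h → (g • y₀, h • y₀) ∈ U := by
    rintro A g h ⟨hg, hg'⟩ ⟨hh, hh'⟩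
    have he := eq_of_forall_lt_iff p q A _ _ hg' hh' (hg.trans hh.symm)
    have := hF (h * g⁻¹) (fun a ha => ?_) (g • y₀)
    · rwa [mul_smul, inv_smul_smul] at this
    · obtain ⟨b, hb, rfl⟩ := (hg ▸ ha : a ∈ (fun x => g • x) '' (A : Set X))
      rw [mul_smul, inv_smul_smul]
      exact (he b hb).symm
  refine ⟨t, ht.to_subtype, fun A => if h : ∃ g, P A g then r (h.choose • y₀) else r y₀, ?_⟩
  intro A A' g g' hc h1 h2 h3 h4
  have h : ∃ g, P A g := ⟨g, h1, h2⟩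
  have h' : ∃ g, P A' g := ⟨g', h3, h4⟩
  beta_reduce at hc
  rw [dif_pos h, dif_pos h'] at hc
  refine hV _ _ _ _ _ (hP A _ _ ⟨h1, h2⟩ h.choose_spec) (hr _) ?_
    (hP A' _ _ ⟨h3, h4⟩ h'.choose_spec)
  rw [hc]
  exact hr _

variable [Fact (PreservesCircularOrder G X)]

/-- The data of a closed condition on a point of `Y`, see `exists_forall_mem`. -/
structure ClosenessCondition (G X Y : Type*) [Group G] [MulAction G X] [CircularOrder X]
    [UniformSpace Y] [MulAction G Y] [Fact (PreservesCircularOrder G X)]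
    (p : CircularCut X) where
  F : Finset X
  U : Set (Y × Y)
  V : Set (Y × Y)
  g : G
  g' : G
  mem : U ∈ 𝓤 Y
  comp : ∀ a b c d e, (a, b) ∈ U → (b, c) ∈ U → (d, c) ∈ U → (e, d) ∈ U → (a, e) ∈ V
  closed : IsClosed V
  small : ∀ v : G, (∀ a ∈ F, v • a = a) → ∀ y : Y, (y, v • y) ∈ U
  agree : ∀ a ∈ F, ∀ b ∈ F, (g • p).lt a b ↔ (g' • p).lt a b

/-- The conditions are closed, so by compactness finitely many suffice. For these, take `S`
homogeneous for all colourings and `k` moving the relevant finite sets into `S`; the point `k⁻¹ •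
y₀` works, as `g * k⁻¹` and `g' * k⁻¹` carry subsets of `S`, of equal colour, monotonically onto
`F`. -/
theorem exists_forall_mem [Infinite X] [Nonempty Y] (hX : IsUltrahomogeneousAction G X)
    (hY : ∀ g : G, Continuous fun y : Y => g • y) (p : CircularCut X) :
    ∃ y : Y, ∀ i : ClosenessCondition G X Y p, (i.g • y, i.g' • y) ∈ i.V := by
  classical
  obtain ⟨y₀⟩ : Nonempty Y := inferInstance
  suffices h : (⋂ i : ClosenessCondition G X Y p,
      {y : Y | (i.g • y, i.g' • y) ∈ i.V}).Nonempty by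
    obtain ⟨y, hy⟩ := h
    exact ⟨y, fun i => Set.mem_iInter.1 hy i⟩
  refine CompactSpace.iInter_nonempty (fun i => i.closed.preimage ((hY _).prodMk (hY _))) ?_
  intro s
  choose κ hκ c hc using fun i : ClosenessCondition G X Y p =>
    exists_coloring p (i.g • p) y₀ i.mem i.comp i.small
  obtain ⟨S, hS, hSc⟩ := exists_infinite_homogeneous_finset (fun i => i.F.card) c s
  obtain ⟨k, hkS, hk⟩ := exists_smul_of_infinite hX p p
    (s.biUnion fun i => i.F.image (i.g⁻¹ • ·) ∪ i.F.image (i.g'⁻¹ • ·)) hS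
  refine ⟨k⁻¹ • y₀, Set.mem_iInter₂.2 fun i hi => ?_⟩
  obtain ⟨col, hcol⟩ := hSc i hi
  have main : ∀ h : G, (h = i.g ∨ h = i.g') →
      c i (i.F.image fun x => k • h⁻¹ • x) = col ∧
      (fun x => (h * k⁻¹) • x) '' ((i.F.image fun x => k • h⁻¹ • x : Finset X) : Set X) = i.F ∧
      ∀ a ∈ i.F.image fun x => k • h⁻¹ • x, ∀ b ∈ i.F.image fun x => k • h⁻¹ • x,
        p.lt a b ↔ (i.g • p).lt ((h * k⁻¹) • a) ((h * k⁻¹) • b) := by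
    intro h hh
    have hB : ∀ x ∈ i.F, h⁻¹ • x ∈
        s.biUnion fun i => i.F.image (i.g⁻¹ • ·) ∪ i.F.image (i.g'⁻¹ • ·) := fun x hx => by
      refine Finset.mem_biUnion.2 ⟨i, hi, ?_⟩
      rcases hh with rfl | rfl
      · exact Finset.mem_union_left _ (Finset.mem_image_of_mem _ hx)
      · exact Finset.mem_union_right _ (Finset.mem_image_of_mem _ hx)
    refine ⟨hcol _ ?_ ?_, ?_, ?_⟩
    · rw [Finset.coe_image]
      rintro _ ⟨x, hx, rfl⟩
      exact hkS _ (hB x hx)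
    · exact Finset.card_image_of_injective _ fun x y hxy =>
        smul_left_cancel _ (smul_left_cancel _ hxy)
    · rw [Finset.coe_image, Set.image_image]
      simp [mul_smul]
    · intro a ha b hb
      obtain ⟨x, hx, rfl⟩ := Finset.mem_image.1 ha
      obtain ⟨y, hy, rfl⟩ := Finset.mem_image.1 hb
      rw [← hk _ (hB x hx) _ (hB y hy), ← smul_lt, mul_smul, mul_smul, inv_smul_smul,
        inv_smul_smul, smul_inv_smul, smul_inv_smul]
      rcases hh with rfl | rfl
      · rfl
      · exact (i.agree x hx y hy).symm
  obtain ⟨a1, a2, a3⟩ := main i.g (.inl rfl)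
  obtain ⟨b1, b2, b3⟩ := main i.g' (.inr rfl)
  have := hc i _ _ _ _ (a1.trans b1.symm) a2 a3 b2 b3
  rwa [mul_smul, mul_smul] at this

theorem exists_equivariant_of_uniformSpace [Infinite X] [Nonempty Y] [T2Space Y]
    [TopologicalSpace G] (hX : IsUltrahomogeneousAction G X)
    (ht : (inferInstance : TopologicalSpace G) = pointwiseTopology G X) [ContinuousSMul G Y] :
    ∃ f : CircularCut X →[G] Y, Continuous f := by
  obtain ⟨x⟩ : Nonempty X := inferInstance
  let p := after x
  obtain ⟨y, hy⟩ := exists_forall_mem (Y := Y) hX continuous_const_smul p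
  have key : ∀ V ∈ 𝓤 Y, ∃ F : Finset X, ∀ g g' : G,
      (∀ a ∈ F, ∀ b ∈ F, (g • p).lt a b ↔ (g' • p).lt a b) → (g • y, g' • y) ∈ V := by
    intro V hV
    obtain ⟨V', ⟨hV', hV'c⟩, hV'V⟩ := uniformity_hasBasis_closed.mem_iff.1 hV
    -- Two halvings, because `comp` chains four `U`-steps; `V'` is closed so that the condition on
    -- `y` is closed.
    obtain ⟨W, hW, hWs, hWV⟩ := comp_symm_mem_uniformity_sets hV'
    obtain ⟨U, hU, hUs, hUW⟩ := comp_symm_mem_uniformity_sets hW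
    obtain ⟨F, hF⟩ := exists_finset_uniformly_small (X := X) ht hU
    have hs : ∀ a b, (a, b) ∈ U → (b, a) ∈ U := fun a b h => hUs.symm _ _ h
    refine ⟨F, fun g g' h => hV'V (hy ⟨F, U, V', g, g', hU, ?_, hV'c, hF, h⟩)⟩
    intro a b c d e h1 h2 h3 h4
    exact hWV ⟨c, hUW ⟨b, h1, h2⟩, hUW ⟨d, hs _ _ h3, hs _ _ h4⟩⟩
  have := isMinimal (G := G) hX
  have hd : DenseRange fun g : G => g • p := MulAction.dense_orbit G p
  obtain ⟨φ, hφ, hφg⟩ := exists_continuous_extension (fun g : G => g • p) hd (fun g => g • y)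
    fun b V hV => by
      obtain ⟨F, hF⟩ := key V hV
      refine ⟨_, mem_nhds_iff.2 ⟨F, subset_rfl⟩, fun g g' hg hg' => hF g g' fun a ha c hc => ?_⟩
      exact (hg a ha c hc).symm.trans (hg' a ha c hc)
  have := continuousSMul (G := G) (X := X) ht
  refine ⟨⟨φ, fun g q => ?_⟩, hφ⟩
  refine congrFun (hd.equalizer (hφ.comp (continuous_const_smul g))
    ((continuous_const_smul g).comp hφ) (funext fun h => ?_)) q
  change φ (g • h • p) = g • φ (h • p)
  rw [← mul_smul, hφg, hφg, mul_smul]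

theorem isUniversalMinimalSystem {G X : Type u} [Group G] [MulAction G X] [CircularOrder X]
    [Fact (PreservesCircularOrder G X)] [Infinite X]
    [TopologicalSpace G] (hX : IsUltrahomogeneousAction G X)
    (ht : (inferInstance : TopologicalSpace G) = pointwiseTopology G X) :
    IsUniversalMinimalSystem G (CircularCut X) where
  isMinimalSystem := isMinimalSystem hX ht
  universal Y _ _ hY := by
    have := hY.compact
    have := hY.hausdorff
    have := hY.nonempty
    have := hY.continuous_action
    let _ : UniformSpace Y := uniformSpaceOfCompactR1
    exact exists_equivariant_of_uniformSpace hX ht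

/-- Every universal minimal system is isomorphic to the system of cuts. -/
theorem exists_homeomorph {G X M : Type u} [Group G] [MulAction G X] [CircularOrder X]
    [Fact (PreservesCircularOrder G X)] [Infinite X]
    [TopologicalSpace G] (hX : IsUltrahomogeneousAction G X)
    (ht : (inferInstance : TopologicalSpace G) = pointwiseTopology G X)
    [TopologicalSpace M] [MulAction G M] (hM : IsUniversalMinimalSystem G M) :
    ∃ e : M ≃ₜ CircularCut X, ∀ (g : G) (m : M), e (g • m) = g • e m := by
  obtain ⟨f, hf⟩ := hM.universal (CircularCut X) (isMinimalSystem hX ht)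
  obtain ⟨h, hh⟩ := (isUniversalMinimalSystem hX ht).universal M hM.isMinimalSystem
  have hfh : ∀ p, f (h p) = p := equivariant_eq_id hX (f.comp h) (hf.comp hh)
  have := hM.isMinimalSystem.hausdorff
  have := hM.isMinimalSystem.minimal
  -- The image is compact and contains a dense orbit.
  have hsurj : Function.Surjective h := by
    obtain ⟨p⟩ := (isMinimalSystem (G := G) hX ht).nonempty
    refine Set.range_eq_univ.1 ((isCompact_range hh).isClosed.closure_eq ▸ ?_)
    refine Dense.closure_eq ((MulAction.dense_orbit G (h p)).mono ?_)
    rintro _ ⟨g, rfl⟩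
    exact ⟨g • p, map_smul h g p⟩
  have hhf : ∀ m, h (f m) = m := fun m => by
    obtain ⟨p, rfl⟩ := hsurj m
    rw [hfh]
  exact ⟨⟨⟨f, h, hhf, hfh⟩, hf, hh⟩, map_smul f⟩

end CircularCut

theorem isCircularlyOrderedSystem_of_homeomorph {G M N : Type*} [Group G] [TopologicalSpace G]
    [TopologicalSpace M] [MulAction G M] [TopologicalSpace N] [MulAction G N] (e : M ≃ₜ N)
    (he : ∀ (g : G) (m : M), e (g • m) = g • e m) (hN : IsCircularlyOrderedSystem G N) :
    IsCircularlyOrderedSystem G M := by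
  obtain ⟨o, hto, hp⟩ := hN
  let o' : CircularOrder M :=
    { btw := fun a b c => btw (e a) (e b) (e c)
      sbtw := fun a b c => sbtw (e a) (e b) (e c)
      btw_refl := fun a => btw_refl (e a)
      btw_cyclic_left := fun h => btw_cyclic_left h
      sbtw_iff_btw_not_btw := sbtw_iff_btw_not_btw
      sbtw_trans_left := fun h h' => sbtw_trans_left h h'
      btw_antisymm := fun h h' => by
        simpa only [e.injective.eq_iff] using btw_antisymm h h'
      btw_total := fun a b c => btw_total (e a) (e b) (e c) }
  refine ⟨o', ?_, fun g a b c h => ?_⟩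
  · refine (e.isInducing.eq_induced.trans (congrArg (TopologicalSpace.induced e) hto)).trans ?_
    rw [circularIntervalTopology, circularIntervalTopology, induced_generateFrom_eq]
    congr 1
    have hpre : ∀ a b : M, e ⁻¹' (circularClosedInterval (e a) (e b))ᶜ =
        (circularClosedInterval a b)ᶜ := fun a b => by
      ext x
      simp only [circularClosedInterval, Set.mem_preimage, Set.mem_compl_iff, Set.mem_union,
        Set.mem_ofPred_eq, Set.mem_insert_iff, Set.mem_singleton_iff, e.injective.eq_iff]
      rfl
    ext U
    constructor
    · rintro ⟨_, ⟨a, b, rfl⟩, rfl⟩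
      obtain ⟨a, rfl⟩ := e.surjective a
      obtain ⟨b, rfl⟩ := e.surjective b
      exact ⟨a, b, hpre a b⟩
    · rintro ⟨a, b, rfl⟩
      exact ⟨_, ⟨e a, e b, rfl⟩, hpre a b⟩
  · change sbtw (e _) (e _) (e _)
    rw [he, he, he]
    exact hp g _ _ _ h

theorem theorem4p4 {G X : Type u} [Group G] [MulAction G X] [CircularOrder X] [Infinite X]
    (hX : IsUltrahomogeneousAction G X)
    [tG : TopologicalSpace G] (hG : tG = pointwiseTopology G X) :
    IsIntrinsicallyCircularlyOrdered G ∧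
      (Countable X →
        ∀ (M : Type u) [TopologicalSpace M] [MulAction G M],
          IsUniversalMinimalSystem G M → TopologicalSpace.MetrizableSpace M) := by
  have : Fact (PreservesCircularOrder G X) := ⟨hX.preserves⟩
  refine ⟨⟨⟨CircularCut X, inferInstance, inferInstance,
    CircularCut.isUniversalMinimalSystem hX hG⟩, fun M _ _ hM => ?_⟩, fun _ M _ _ hM => ?_⟩
  · obtain ⟨e, he⟩ := CircularCut.exists_homeomorph hX hG hM
    exact isCircularlyOrderedSystem_of_homeomorph e he ⟨inferInstance,
      CircularCut.topology_eq_circularIntervalTopology fun p _ _ => CircularCut.exists_lt_lt hX p,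
      CircularCut.preservesCircularOrder⟩
  · obtain ⟨e, -⟩ := CircularCut.exists_homeomorph hX hG hM
    have := CircularCut.metrizableSpace (X := X)
    exact e.isEmbedding.metrizableSpace
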